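/- For $\rho>1$ let $E_\rho=\{\tfrac12(z+z^{-1}) : z\in\mathbb{C},\ |z|=\rho\}$ be the Bernstein ellipse, and let its interior be the open region of $\mathbb{C}$ enclosed by it (which contains $[-1,1]$). There are universal constants $C,K>0$ such that the following holds. Let $\alpha>0$, $\rho=1+\alpha$, and let $f$ be a complex-valued function that is analytic in the interior of $E_\rho$ and satisfies $|f(z)|\le M$ there. Then for all $\delta\in\bigl(0,\tfrac1C\min(1,\alpha^2)\bigr)$, $\varepsilon\in(0,1)$ and $b>1$ there is a polynomial $q$ with complex coefficients, of degree at most $K\,\frac{b}{\delta}\log\frac{b}{\delta\varepsilon}$, such that $$|f(x)-q(x)|\le M\varepsilon \quad\text{for } x\in[-1,1],$$ $$|q(x)|\le M \quad\text{for } x\in[-(1+\delta),1+\delta],$$ $$|q(x)|\le M\varepsilon \quad\text{for } x\in[-b,-(1+\delta)]\cup[1+\delta,b]$$ (the last set is empty if $b<1+\delta$). Moreover, $q$ can be chosen so that, in addition, $q$ is even if $f$ is even on $[-1,1]$, $q$ is odd if $f$ is odd on $[-1,1]$, and $q$ has real coefficients if $f$ is real-valued on $[-1,1]$. -/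

import Mathlib

/-- The Bernstein ellipse (a closed curve; the segment `[-1, 1]` when `ρ = 1`):
`E_ρ = {(z + z⁻¹) / 2 : |z| = ρ}`. -/
def bernsteinEllipse (ρ : ℝ) : Set ℂ :=
  {w | ∃ z : ℂ, ‖z‖ = ρ ∧ w = (1 / 2) * (z + z⁻¹)}

/-- The interior of the Bernstein ellipse `E_ρ`, i.e. the open region enclosed by the curve. The
confocal ellipses `E_r`, `1 ≤ r < ρ`, starting from `E_1 = [-1, 1]`, fill out this region. -/
def bernsteinInterior (ρ : ℝ) : Set ℂ :=
  ⋃ r ∈ Set.Ico (1 : ℝ) ρ, bernsteinEllipse r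

/-! Reduce to α ≤ 1 and b ≥ 2, and let L = log(b/(δε)). Truncating the Chebyshev series of f at a
degree of order L/α gives a polynomial p close to f on [-(1+δ), 1+δ]: since δ ≲ α², and a point δ
beyond 1 has Joukowsky radius at most exp(√(2δ)), this interval stays well inside the ellipse.
Further out p grows, but at most like M exp(L(2 + √(s/δ))) when the distances to the foci sum to 2 +
2s.

Now multiply p by an entire window r: the indicator of [-(1+δ/2), 1+δ/2] convolved with a Gaussian
of width of order δ/√L. It is nearly 1 on [-1, 1], and at real distance τδ ≥ δ from [-1, 1] it is at
most exp(-20L(τ-1/2)²), which beats the growth of p. On the strip |Im z| ≤ δ the window costs only a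
factor exp(20L), so g = p r is bounded there by M exp(24L).

Finally g is replaced by a polynomial on [-b, b], by truncating the Chebyshev series of z ↦ g(bz):
the Bernstein ellipse of parameter 1 + δ/b, dilated by b, lies in the strip. The error decays like
(1+δ/b)^(-n), so n of order (b/δ)L suffices, whatever the degree of p. Dividing by 1 + ε/5 makes the
bound on the middle interval exactly M. Parity and reality come from averaging, because the
constraints on q are convex. -/

open Complex MeasureTheory Filter Topology

/-! ### Laurent series on an annulus -/

/-- Laurent expansion of a bounded holomorphic function on an annulus, with Cauchy's estimates. -/
theorem exists_laurent_expansion {r₁ r₂ M : ℝ} (h₁ : 0 < r₁) {F : ℂ → ℂ}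
    (hF : ∀ z, r₁ < ‖z‖ → ‖z‖ < r₂ → DifferentiableAt ℂ F z)
    (hM : ∀ z, r₁ < ‖z‖ → ‖z‖ < r₂ → ‖F z‖ ≤ M) :
    ∃ c : ℤ → ℂ, (∀ n r, r₁ < r → r < r₂ → ‖c n‖ * r ^ n ≤ M) ∧
      ∀ z, r₁ < ‖z‖ → ‖z‖ < r₂ → HasSum (fun n => c n * z ^ n) (F z) := by
  let J : ℝ → ℤ → ℂ := fun r n =>
    (2 * Real.pi * I)⁻¹ • ∮ z in C(0, r), (z - 0)⁻¹ • (z ^ (-n) * F z)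
  -- By Cauchy's theorem the coefficient integral does not depend on the radius.
  have hmono : ∀ r s n, r₁ < r → r ≤ s → s < r₂ → J s n = J r n := by
    intro r s n hr hrs hs
    have hd : ∀ z, r ≤ ‖z‖ → ‖z‖ ≤ s →
        DifferentiableAt ℂ (fun z : ℂ => z ^ (-n) * F z) z := fun z h h' =>
      (differentiableAt_zpow.2 (Or.inl (norm_pos_iff.1 (h₁.trans (hr.trans_le h))))).mul
        (hF z (hr.trans_le h) (h'.trans_lt hs))
    simp only [J]
    rw [circleIntegral_sub_center_inv_smul_eq_of_differentiable_on_annulus_off_countable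
      (h₁.trans hr) hrs Set.countable_empty]
    · intro z hz
      simp only [Set.mem_sdiff, Metric.mem_closedBall, Metric.mem_ball, dist_zero_right,
        not_lt] at hz
      exact (hd z hz.2 hz.1).continuousAt.continuousWithinAt
    · intro z hz
      simp only [Set.mem_sdiff, Metric.mem_closedBall, Metric.mem_ball, dist_zero_right,
        not_le] at hz
      exact hd z hz.1.2.le hz.1.1.le
  let r₀ := (r₁ + r₂) / 2
  have hJ : ∀ r n, r₁ < r → r < r₂ → J r₀ n = J r n := by
    intro r n hr hr'
    rcases le_total r r₀ with h | h
    · exact hmono r r₀ n hr h (by simp only [r₀]; linarith)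
    · exact (hmono r₀ r n (by simp only [r₀]; linarith) h hr').symm
  have hbound : ∀ n r, r₁ < r → r < r₂ → ‖J r₀ n‖ * r ^ n ≤ M := by
    intro n r hr hr'
    have hr0 : 0 < r := h₁.trans hr
    rw [hJ r n hr hr']
    have := circleIntegral.norm_two_pi_i_inv_smul_integral_le_of_norm_le_const (c := (0 : ℂ))
      (f := fun z : ℂ => (z - 0)⁻¹ • (z ^ (-n) * F z)) (C := r⁻¹ * (r ^ (-n) * M)) hr0.le (by
        intro z hz
        have hz' : ‖z‖ = r := by simpa using hz
        rw [sub_zero, norm_smul, norm_mul, norm_inv, norm_zpow, hz']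
        have := hM z (by rw [hz']; exact hr) (by rw [hz']; exact hr')
        gcongr)
    calc ‖J r n‖ * r ^ n ≤ (r * (r⁻¹ * (r ^ (-n) * M))) * r ^ n := by gcongr
      _ = M := by rw [zpow_neg]; field_simp
  refine ⟨J r₀, hbound, fun z hz hz' => ?_⟩
  have : Fact (0 < 2 * Real.pi) := ⟨Real.two_pi_pos⟩
  have hz0 : z ≠ 0 := norm_pos_iff.1 (h₁.trans hz)
  have hr0 : 0 < ‖z‖ := h₁.trans hz
  have hn : ∀ t : AddCircle (2 * Real.pi), ‖(‖z‖ : ℂ) * (t.toCircle : ℂ)‖ = ‖z‖ := by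
    intro t; rw [norm_mul, Circle.norm_coe]; simp
  -- On the circle through `z` the Laurent series is a Fourier series with coefficients `J r₀ n *
  -- ‖z‖ ^ n`; once these are summable it converges pointwise.
  let h : C(AddCircle (2 * Real.pi), ℂ) :=
    ⟨fun t => F (‖z‖ * t.toCircle), by
      rw [continuous_iff_continuousAt]
      intro t
      have hc := (hF (‖z‖ * t.toCircle) (by rwa [hn]) (by rwa [hn])).continuousAt
      refine ContinuousAt.comp (f := fun t : AddCircle (2 * Real.pi) =>
        (‖z‖ : ℂ) * (t.toCircle : ℂ)) hc ?_
      exact (continuous_const.mul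
        (continuous_subtype_val.comp AddCircle.continuous_toCircle)).continuousAt⟩
  have hcoe : ∀ x : ℝ, ((AddCircle.toCircle (x : AddCircle (2 * Real.pi)) : Circle) : ℂ)
      = exp (x * I) := by
    intro x
    rw [AddCircle.toCircle_apply_mk, Circle.coe_exp]
    congr 2
    have := Real.pi_ne_zero
    push_cast
    field_simp
  have hcoeff : ∀ n, fourierCoeff h n = J r₀ n * (‖z‖ : ℂ) ^ n := by
    intro n
    rw [hJ ‖z‖ n hz hz', fourierCoeff_eq_intervalIntegral _ _ 0]
    simp only [J, circleIntegral, smul_eq_mul, zero_add, deriv_circleMap]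
    rw [mul_assoc, ← intervalIntegral.integral_mul_const, Complex.real_smul,
      mul_inv, mul_comm _ I⁻¹, mul_assoc, mul_left_comm,
      ← intervalIntegral.integral_const_mul I⁻¹]
    push_cast
    rw [one_div]
    congr 1
    refine intervalIntegral.integral_congr fun x _ => ?_
    have he : circleMap 0 ‖z‖ x = ‖z‖ * exp (x * I) := by simp [circleMap]
    have hf : fourier (-n) (x : AddCircle (2 * Real.pi)) = exp (x * I) ^ (-n) := by
      rw [fourier_apply, AddCircle.toCircle_zsmul, Circle.coe_zpow, hcoe]
    have hh : h (x : AddCircle (2 * Real.pi)) = F (‖z‖ * exp (x * I)) := by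
      simp only [h, ContinuousMap.coe_mk, hcoe]
    simp only [hf, hh, he, sub_zero]
    have hzn : (‖z‖ : ℂ) ≠ 0 := by exact_mod_cast hr0.ne'
    have hen := exp_ne_zero (x * I)
    rw [mul_zpow, zpow_neg, zpow_neg]
    field_simp
  have hsum : Summable (fourierCoeff h) := by
    obtain ⟨s, hs, hs'⟩ := exists_between hz
    obtain ⟨t, ht, ht'⟩ := exists_between hz'
    have hs0 : 0 < s := h₁.trans hs
    have ht0 : 0 < t := hr0.trans ht
    have hM0 : 0 ≤ M := (norm_nonneg _).trans (hM z hz hz')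
    -- Cauchy's estimate on the larger radius `t` controls positive indices, on the smaller radius
    -- `s` negative ones.
    refine Summable.of_nat_of_neg ?_ ?_
    · refine Summable.of_norm_bounded (g := fun n : ℕ => M * (‖z‖ / t) ^ n)
        ((summable_geometric_of_lt_one (by positivity) ((div_lt_one ht0).2 ht)).mul_left M) ?_
      intro n
      have := hbound n t (hz.trans ht) ht'
      rw [zpow_natCast] at this
      rw [hcoeff, norm_mul, norm_zpow, zpow_natCast, norm_real, norm_norm, div_pow, ← mul_div_assoc,
        le_div_iff₀ (by positivity)]
      calc _ = (‖J r₀ n‖ * t ^ n) * ‖z‖ ^ n := by ring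
        _ ≤ _ := by gcongr
    · refine Summable.of_norm_bounded (g := fun n : ℕ => M * (s / ‖z‖) ^ n)
        ((summable_geometric_of_lt_one (by positivity) ((div_lt_one hr0).2 hs')).mul_left M) ?_
      intro n
      have := hbound (-n) s hs (hs'.trans hz')
      rw [zpow_neg, zpow_natCast, ← div_eq_mul_inv, div_le_iff₀ (by positivity)] at this
      rw [hcoeff, norm_mul, norm_zpow, zpow_neg, zpow_natCast, norm_real, norm_norm, div_pow,
        ← mul_div_assoc, ← div_eq_mul_inv]
      gcongr
  have hfs := has_pointwise_sum_fourier_series_of_summable hsum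
    ((arg z : ℝ) : AddCircle (2 * Real.pi))
  have hzarg : (‖z‖ : ℂ) * exp (arg z * I) = z := norm_mul_exp_arg_mul_I z
  convert hfs using 2 with n
  · rw [hcoeff, fourier_apply, AddCircle.toCircle_zsmul, Circle.coe_zpow, hcoe, smul_eq_mul,
      mul_assoc, ← mul_zpow, hzarg]
  · simp only [h, ContinuousMap.coe_mk, hcoe, hzarg]

/-! ### Joukowsky map and Chebyshev polynomials -/

theorem mem_bernsteinInterior {ρ : ℝ} {w : ℂ} (h₁ : ρ⁻¹ < ‖w‖) (h₂ : ‖w‖ < ρ) :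
    (1 / 2) * (w + w⁻¹) ∈ bernsteinInterior ρ := by
  simp only [bernsteinInterior, Set.mem_iUnion]
  have hρ : 0 < ρ := (norm_nonneg w).trans_lt h₂
  have hw : 0 < ‖w‖ := (inv_pos.2 hρ).trans h₁
  -- `w` and `w⁻¹` have the same image, so the part of the annulus inside the unit circle folds onto
  -- the part outside.
  rcases le_total 1 ‖w‖ with h | h
  · exact ⟨‖w‖, ⟨h, h₂⟩, w, rfl, rfl⟩
  · exact ⟨‖w⁻¹‖, ⟨by rw [norm_inv]; exact (one_le_inv₀ hw).2 h,
      by rw [norm_inv]; exact inv_lt_of_inv_lt₀ hρ h₁⟩, w⁻¹, rfl, by rw [inv_inv, add_comm]⟩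

theorem bernsteinInterior_mono {ρ σ : ℝ} (h : ρ ≤ σ) :
    bernsteinInterior ρ ⊆ bernsteinInterior σ :=
  Set.biUnion_subset_biUnion_left (Set.Ico_subset_Ico_right h)

theorem chebyshev_T_eval_joukowsky (n : ℤ) {w : ℂ} (hw : w ≠ 0) :
    (Polynomial.Chebyshev.T ℂ n).eval ((1 / 2) * (w + w⁻¹)) = (1 / 2) * (w ^ n + w ^ (-n)) := by
  induction n using Polynomial.Chebyshev.induct' with
  | zero => norm_num
  | one => simp
  | add_two n h₁ h₂ =>
    rw [Polynomial.Chebyshev.T_add_two]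
    simp only [Polynomial.eval_sub, Polynomial.eval_mul, Polynomial.eval_X,
      Polynomial.eval_ofNat, h₁, h₂]
    simp only [neg_add, zpow_add₀ hw, zpow_natCast, zpow_neg, zpow_ofNat]
    field_simp
    ring
  | neg n h => rw [Polynomial.Chebyshev.T_neg, h, neg_neg, add_comm]

theorem norm_chebyshev_T_eval_joukowsky_le (n : ℕ) {w : ℂ} (hw : 1 ≤ ‖w‖) :
    ‖(Polynomial.Chebyshev.T ℂ n).eval ((1 / 2) * (w + w⁻¹))‖ ≤ ‖w‖ ^ n := by
  have hw0 : w ≠ 0 := norm_pos_iff.1 (by linarith)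
  rw [chebyshev_T_eval_joukowsky n hw0, norm_mul]
  have h1 : 1 ≤ ‖w‖ ^ n := one_le_pow₀ hw
  have h2 : ‖w ^ (n : ℤ) + w ^ (-(n : ℤ))‖ ≤ ‖w‖ ^ n + (‖w‖ ^ n)⁻¹ := by
    refine (norm_add_le _ _).trans (le_of_eq ?_)
    rw [norm_zpow, norm_zpow, zpow_neg, zpow_natCast]
  have h3 : (‖w‖ ^ n)⁻¹ ≤ 1 := inv_le_one_of_one_le₀ h1
  have h4 : ‖(1 / 2 : ℂ)‖ = 1 / 2 := by norm_num
  rw [h4]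
  linarith

/-! ### Chebyshev series and their truncations -/

/-- Chebyshev series of a function analytic inside a Bernstein ellipse. -/
theorem exists_chebyshev_expansion {ρ M : ℝ} (hρ : 1 < ρ) {f : ℂ → ℂ}
    (hf : AnalyticOnNhd ℂ f (bernsteinInterior ρ))
    (hM : ∀ z ∈ bernsteinInterior ρ, ‖f z‖ ≤ M) :
    ∃ a : ℕ → ℂ, (∀ k, ‖a k‖ * ρ ^ k ≤ 2 * M) ∧
      ∀ w : ℂ, 1 ≤ ‖w‖ → ‖w‖ < ρ →
        HasSum (fun k : ℕ => a k * (Polynomial.Chebyshev.T ℂ k).eval ((1 / 2) * (w + w⁻¹)))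
          (f ((1 / 2) * (w + w⁻¹))) := by
  have hρ0 : 0 < ρ := by linarith
  have hρ1 : ρ⁻¹ < 1 := inv_lt_one_of_one_lt₀ hρ
  obtain ⟨c, hc, hs⟩ := exists_laurent_expansion (inv_pos.2 hρ0) (r₂ := ρ) (M := M)
    (F := fun w => f ((1 / 2) * (w + w⁻¹)))
    (fun z hz hz' => by
      have hz0 : z ≠ 0 := norm_pos_iff.1 ((inv_pos.2 hρ0).trans hz)
      exact DifferentiableAt.comp z
        (hf _ (mem_bernsteinInterior hz hz')).differentiableAt
        ((differentiableAt_id.add (differentiableAt_inv hz0)).const_mul _))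
    (fun z hz hz' => hM _ (mem_bernsteinInterior hz hz'))
  have hM0 : 0 ≤ M := (norm_nonneg _).trans
    (hM _ (mem_bernsteinInterior (w := 1) (by simpa using hρ1) (by simpa using hρ)))
  refine ⟨fun k => if k = 0 then c 0 else c k + c (-k), fun k => ?_, fun w hw hw' => ?_⟩
  · have key : ∀ r ∈ Set.Ioo 1 ρ,
        ‖if k = 0 then c 0 else c k + c (-k)‖ * r ^ k ≤ 2 * M := by
      intro r hr
      have hr0 : 0 < r := by linarith [hr.1]
      have h1 := hc k r (hρ1.trans hr.1) hr.2
      have h2 := hc (-k) r⁻¹ ((inv_lt_inv₀ hρ0 hr0).2 hr.2)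
        ((inv_lt_one_of_one_lt₀ hr.1).trans hρ)
      rw [zpow_neg, inv_zpow, inv_inv, zpow_natCast] at h2
      rw [zpow_natCast] at h1
      split_ifs with hk
      · subst hk
        simp only [Nat.cast_zero, pow_zero, mul_one] at h1 ⊢
        linarith
      · calc _ ≤ (‖c k‖ + ‖c (-k)‖) * r ^ k := by gcongr; exact norm_add_le _ _
          _ ≤ _ := by linarith
    -- Cauchy's estimates need r < ρ; the bound at ρ itself is their limit.
    refine le_of_tendsto (f := fun r : ℝ => ‖if k = 0 then c 0 else c k + c (-k)‖ * r ^ k)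
      (x := 𝓝[<] ρ) ?_ ?_
    · exact (Continuous.tendsto (by fun_prop) ρ).mono_left nhdsWithin_le_nhds
    · filter_upwards [Ioo_mem_nhdsLT hρ] with r hr using key r hr
  · have hw0 : w ≠ 0 := norm_pos_iff.1 (by linarith)
    have hwi : ‖w⁻¹‖ ≤ 1 := by rw [norm_inv]; exact inv_le_one_of_one_le₀ hw
    have h1 := hs w (hρ1.trans_le hw) hw'
    have h2 := hs w⁻¹ (by rw [norm_inv]; exact (inv_lt_inv₀ hρ0 (by linarith)).2 hw')
      (hwi.trans_lt hρ)
    rw [inv_inv, add_comm w⁻¹ w] at h2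
    -- Averaging the expansions at `w` and `w⁻¹` turns each power into a Chebyshev polynomial.
    have h3 := (h1.add h2).mul_left (1 / 2)
    have h4 : HasSum (fun n : ℤ => c n *
        (Polynomial.Chebyshev.T ℂ n).eval ((1 / 2) * (w + w⁻¹))) (f ((1 / 2) * (w + w⁻¹))) := by
      rw [show f ((1 / 2) * (w + w⁻¹)) = 1 / 2 * (f (1 / 2 * (w + w⁻¹)) + f (1 / 2 * (w + w⁻¹)))
        by ring]
      refine Eq.subst (motive := fun g => HasSum g _) (funext fun n => Eq.symm ?_) h3
      rw [chebyshev_T_eval_joukowsky n hw0, zpow_neg, inv_zpow]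
      ring
    -- Pairing `n` with `-n` counts the index 0 twice, so one copy is removed.
    have h6 := h4.nat_add_neg.sub (hasSum_ite_eq (0 : ℕ) (c 0))
    rw [Polynomial.Chebyshev.T_zero, Polynomial.eval_one, mul_one, add_sub_cancel_right] at h6
    refine Eq.subst (motive := fun g => HasSum g _) (funext fun k => Eq.symm ?_) h6
    by_cases hk : k = 0
    · subst hk; simp
    · simp only [hk, if_false, sub_zero, Polynomial.Chebyshev.T_neg]
      ring

/-- The partial sum of a Chebyshev series. -/
noncomputable def chebyshevPartialSum (a : ℕ → ℂ) (n : ℕ) : Polynomial ℂ :=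
  ∑ k ∈ Finset.range (n + 1), Polynomial.C (a k) * Polynomial.Chebyshev.T ℂ k

theorem eval_chebyshevPartialSum (a : ℕ → ℂ) (n : ℕ) (z : ℂ) :
    (chebyshevPartialSum a n).eval z =
      ∑ k ∈ Finset.range (n + 1), a k * (Polynomial.Chebyshev.T ℂ k).eval z := by
  simp [chebyshevPartialSum, Polynomial.eval_finsetSum]

theorem natDegree_chebyshevPartialSum_le (a : ℕ → ℂ) (n : ℕ) :
    (chebyshevPartialSum a n).natDegree ≤ n := by
  refine Polynomial.natDegree_sum_le_of_forall_le _ _ fun k hk => ?_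
  refine (Polynomial.natDegree_C_mul_le _ _).trans ?_
  rw [Polynomial.Chebyshev.natDegree_T, Int.natAbs_natCast]
  exact Nat.lt_succ_iff.1 (Finset.mem_range.1 hk)

section

variable {a : ℕ → ℂ} {ρ M : ℝ}

theorem norm_sub_chebyshevPartialSum_le (ha : ∀ k, ‖a k‖ * ρ ^ k ≤ 2 * M) {w : ℂ}
    (hw : 1 ≤ ‖w‖) (hwρ : ‖w‖ < ρ) {y : ℂ}
    (hy : HasSum (fun k : ℕ => a k * (Polynomial.Chebyshev.T ℂ k).eval ((1 / 2) * (w + w⁻¹))) y)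
    (n : ℕ) :
    ‖y - (chebyshevPartialSum a n).eval ((1 / 2) * (w + w⁻¹))‖ ≤
      2 * M * (‖w‖ / ρ) ^ (n + 1) / (1 - ‖w‖ / ρ) := by
  have hρ0 : 0 < ρ := by linarith
  rw [eval_chebyshevPartialSum, norm_sub_rev, ← dist_eq_norm]
  refine dist_le_of_le_geometric_of_tendsto (‖w‖ / ρ) (2 * M) ((div_lt_one hρ0).2 hwρ) ?_
    hy.tendsto_sum_nat (n + 1)
  intro k
  rw [dist_comm, dist_eq_norm, Finset.sum_range_succ, add_sub_cancel_left, norm_mul, div_pow,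
    ← mul_div_assoc, le_div_iff₀ (by positivity)]
  calc _ ≤ ‖a k‖ * ‖w‖ ^ k * ρ ^ k := by
        gcongr; exact norm_chebyshev_T_eval_joukowsky_le k hw
    _ = (‖a k‖ * ρ ^ k) * ‖w‖ ^ k := by ring
    _ ≤ _ := mul_le_mul_of_nonneg_right (ha k) (by positivity)

/-- Bounding ‖w‖^k by ‖w‖^n leaves a geometric series in ρ⁻¹. There is no upper limit on ‖w‖: this
controls the growth outside the ellipse. -/
theorem norm_eval_chebyshevPartialSum_le (hρ : 1 < ρ) (ha : ∀ k, ‖a k‖ * ρ ^ k ≤ 2 * M) {w : ℂ}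
    (hw : 1 ≤ ‖w‖) (n : ℕ) :
    ‖(chebyshevPartialSum a n).eval ((1 / 2) * (w + w⁻¹))‖ ≤
      2 * M * (ρ / (ρ - 1)) * ‖w‖ ^ n := by
  have hρ0 : 0 < ρ := by linarith
  have hM0 : 0 ≤ 2 * M := le_trans (by positivity) (ha 0)
  rw [eval_chebyshevPartialSum]
  calc _ ≤ ∑ k ∈ Finset.range (n + 1), 2 * M * ‖w‖ ^ n * (ρ⁻¹) ^ k := by
        refine norm_sum_le_of_le _ fun k hk => ?_
        have hk' : k ≤ n := Nat.lt_succ_iff.1 (Finset.mem_range.1 hk)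
        rw [norm_mul, inv_pow, ← div_eq_mul_inv, le_div_iff₀ (by positivity)]
        calc _ ≤ ‖a k‖ * ‖w‖ ^ k * ρ ^ k := by
              gcongr; exact norm_chebyshev_T_eval_joukowsky_le k hw
          _ = (‖a k‖ * ρ ^ k) * ‖w‖ ^ k := by ring
          _ ≤ 2 * M * ‖w‖ ^ n :=
            mul_le_mul (ha k) (pow_le_pow_right₀ hw hk') (by positivity) hM0
    _ = 2 * M * ‖w‖ ^ n * ∑ k ∈ Finset.range (n + 1), (ρ⁻¹) ^ k := by rw [Finset.mul_sum]
    _ ≤ 2 * M * ‖w‖ ^ n * (1 - ρ⁻¹)⁻¹ := by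
        gcongr
        have := (summable_geometric_of_lt_one (inv_pos.2 hρ0).le
          (inv_lt_one_of_one_lt₀ hρ)).sum_le_tsum (Finset.range (n + 1))
          (fun k _ => by positivity)
        rwa [tsum_geometric_of_lt_one (inv_pos.2 hρ0).le (inv_lt_one_of_one_lt₀ hρ)] at this
    _ = _ := by
        have : ρ - 1 ≠ 0 := by linarith
        have h2 : 1 - ρ⁻¹ = (ρ - 1) / ρ := by field_simp
        rw [h2, inv_div]
        ring

end

/-! ### Joukowsky radius and distances to the foci -/

/-- Joukowsky parametrisation of the plane by the exterior of the unit disc, in terms of the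
distances to the foci `±1`. -/
theorem exists_joukowsky (z : ℂ) :
    ∃ w : ℂ, 1 ≤ ‖w‖ ∧ z = (1 / 2) * (w + w⁻¹) ∧ ‖w‖ + ‖w‖⁻¹ = ‖z - 1‖ + ‖z + 1‖ := by
  -- The two preimages z ± s are mutually inverse, so one of them has norm at least 1.
  obtain ⟨s, hs⟩ := IsAlgClosed.exists_eq_mul_self (z ^ 2 - 1)
  have key : ∀ w v : ℂ, w * v = 1 → w + v = 2 * z → 1 ≤ ‖w‖ →
      ∃ w : ℂ, 1 ≤ ‖w‖ ∧ z = (1 / 2) * (w + w⁻¹) ∧ ‖w‖ + ‖w‖⁻¹ = ‖z - 1‖ + ‖z + 1‖ := by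
    intro w v hwv hz hw
    obtain rfl : v = w⁻¹ := eq_inv_of_mul_eq_one_right hwv
    have hw0 : w ≠ 0 := norm_pos_iff.1 (by linarith)
    refine ⟨w, hw, by rw [hz]; ring, ?_⟩
    have hz' : z = (1 / 2) * (w + w⁻¹) := by rw [hz]; ring
    have h1 : z - 1 = (w - 1) ^ 2 / (2 * w) := by rw [hz']; field_simp; ring
    have h2 : z + 1 = (w + 1) ^ 2 / (2 * w) := by rw [hz']; field_simp; ring
    have h3 := parallelogram_law_with_norm ℝ w 1
    rw [norm_one] at h3
    have hn : ‖w‖ ≠ 0 := norm_ne_zero_iff.2 hw0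
    rw [h1, h2, norm_div, norm_div, norm_pow, norm_pow, norm_mul, Complex.norm_two]
    field_simp
    linarith
  have hprod : (z + s) * (z - s) = 1 := by linear_combination hs
  rcases le_total 1 ‖z + s‖ with h | h
  · exact key _ _ hprod (by ring) h
  · refine key (z - s) (z + s) (by rw [mul_comm, hprod]) (by ring) ?_
    have : ‖z + s‖ * ‖z - s‖ = 1 := by rw [← norm_mul, hprod, norm_one]
    nlinarith [norm_nonneg (z - s)]

/-- With R = exp t the hypothesis reads cosh t ≤ 1 + s, while cosh v ≥ 1 + v²/2. -/
theorem le_exp_sqrt_of_add_inv_le {R s : ℝ} (hR : 1 ≤ R) (hs : 0 ≤ s)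
    (h : R + R⁻¹ ≤ 2 + 2 * s) : R ≤ Real.exp (√(2 * s)) := by
  set v := √(2 * s) with hv
  have hv0 : 0 ≤ v := Real.sqrt_nonneg _
  have hv2 : v ^ 2 = 2 * s := Real.sq_sqrt (by linarith)
  have hR0 : 0 < R := by linarith
  have h1 : Real.cosh (Real.log R) ≤ 1 + s := by rw [Real.cosh_log hR0]; linarith
  have h2 : 1 + s ≤ Real.cosh v := by
    have := Real.self_le_sinh_iff.2 (show 0 ≤ v / 2 by linarith)
    have h3 := Real.cosh_two_mul (v / 2)
    have h4 := Real.cosh_sq (v / 2)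
    rw [mul_div_cancel₀ _ two_ne_zero] at h3
    nlinarith
  have h3 := (Real.cosh_le_cosh).1 (h1.trans h2)
  rw [abs_of_nonneg (Real.log_nonneg hR), abs_of_nonneg hv0] at h3
  exact (Real.log_le_iff_le_exp hR0).1 h3

/-! ### The Gaussian window -/

/-- The density of a centred Gaussian with variance `1 / (2 k)`. -/
noncomputable def gaussianBump (k u : ℝ) : ℝ := √(k / Real.pi) * Real.exp (-k * u ^ 2)

theorem gaussianBump_nonneg (k u : ℝ) : 0 ≤ gaussianBump k u := by
  unfold gaussianBump; positivity

theorem integrable_gaussianBump {k : ℝ} (hk : 0 < k) : Integrable (gaussianBump k) :=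
  (integrable_exp_neg_mul_sq hk).const_mul _

theorem integral_gaussianBump {k : ℝ} (hk : 0 < k) : ∫ u, gaussianBump k u = 1 := by
  unfold gaussianBump
  rw [integral_const_mul, integral_gaussian, ← Real.sqrt_mul (by positivity),
    div_mul_div_cancel₀ Real.pi_ne_zero, div_self hk.ne', Real.sqrt_one]

theorem gaussianBump_le_mul {k u v w : ℝ} (hk : 0 < k) (h : v ^ 2 + w ^ 2 ≤ u ^ 2) :
    gaussianBump k u ≤ Real.exp (-k * v ^ 2) * gaussianBump k w := by
  unfold gaussianBump
  rw [mul_left_comm, ← Real.exp_add]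
  gcongr
  nlinarith

/-- The Gaussian smoothing of the indicator function of `[-a, a]`. -/
noncomputable def gaussianWindow (k a x : ℝ) : ℝ := ∫ u in Set.Ioc (-a) a, gaussianBump k (x - u)

section

variable {k a : ℝ}

theorem gaussianWindow_nonneg (k a x : ℝ) : 0 ≤ gaussianWindow k a x :=
  integral_nonneg fun _ => gaussianBump_nonneg _ _

theorem setIntegral_gaussianBump_le_one (hk : 0 < k) (x : ℝ) (s : Set ℝ) :
    ∫ u in s, gaussianBump k (x - u) ≤ 1 := by
  rw [← integral_gaussianBump hk, ← integral_sub_left_eq_self (gaussianBump k) volume x]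
  exact setIntegral_le_integral ((integrable_gaussianBump hk).comp_sub_left x)
    (Eventually.of_forall fun u => gaussianBump_nonneg _ _)

theorem gaussianWindow_le_one (hk : 0 < k) (x : ℝ) : gaussianWindow k a x ≤ 1 :=
  setIntegral_gaussianBump_le_one hk x _

/-- For u in the window, the nearer endpoint c = ±a satisfies (x-u)² ≥ (|x|-a)² + (c-u)². The first
term gives the factor; the Gaussian recentred at c has mass at most 1. -/
theorem gaussianWindow_le_exp (hk : 0 < k) {x : ℝ} (hx : a ≤ |x|) :
    gaussianWindow k a x ≤ Real.exp (-k * (|x| - a) ^ 2) := by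
  have key : ∀ c : ℝ, (∀ u ∈ Set.Ioc (-a) a, (|x| - a) ^ 2 + (c - u) ^ 2 ≤ (x - u) ^ 2) →
      gaussianWindow k a x ≤ Real.exp (-k * (|x| - a) ^ 2) := by
    intro c hc
    have hi : ∀ y, Integrable (fun u => gaussianBump k (y - u)) := fun y =>
      (integrable_gaussianBump hk).comp_sub_left y
    calc gaussianWindow k a x
        ≤ ∫ u in Set.Ioc (-a) a, Real.exp (-k * (|x| - a) ^ 2) * gaussianBump k (c - u) :=
          setIntegral_mono_on (hi x).integrableOn ((hi c).const_mul _).integrableOn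
            measurableSet_Ioc fun u hu => gaussianBump_le_mul hk (hc u hu)
      _ = Real.exp (-k * (|x| - a) ^ 2) * ∫ u in Set.Ioc (-a) a, gaussianBump k (c - u) :=
          integral_const_mul _ _
      _ ≤ Real.exp (-k * (|x| - a) ^ 2) * 1 := by
          gcongr; exact setIntegral_gaussianBump_le_one hk _ _
      _ = _ := mul_one _
  rcases abs_cases x with ⟨h, h'⟩ | ⟨h, h'⟩
  · refine key a fun u hu => ?_
    rw [h] at hx ⊢
    nlinarith [mul_nonneg (sub_nonneg.2 hx) (sub_nonneg.2 hu.2)]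
  · refine key (-a) fun u hu => ?_
    rw [h] at hx ⊢
    nlinarith [mul_nonneg (sub_nonneg.2 hx) (sub_nonneg.2 hu.1.le)]

theorem one_sub_gaussianWindow_le (hk : 0 < k) {x : ℝ} (hx : |x| ≤ a) :
    1 - gaussianWindow k a x ≤ 2 * Real.exp (-k * (a - |x|) ^ 2) := by
  have hi : ∀ y, Integrable (fun u => gaussianBump k (y - u)) := fun y =>
    (integrable_gaussianBump hk).comp_sub_left y
  have h1 : 1 - gaussianWindow k a x =
      ∫ u in (Set.Ioc (-a) a)ᶜ, gaussianBump k (x - u) := by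
    rw [sub_eq_iff_eq_add', gaussianWindow, integral_add_compl measurableSet_Ioc (hi x),
      integral_sub_left_eq_self (gaussianBump k) volume x, integral_gaussianBump hk]
  rw [h1]
  calc _ ≤ ∫ u in (Set.Ioc (-a) a)ᶜ, Real.exp (-k * (a - |x|) ^ 2) *
        (gaussianBump k (a - u) + gaussianBump k (-a - u)) := by
        refine setIntegral_mono_on (hi x).integrableOn
          (((hi a).add (hi (-a))).const_mul _).integrableOn measurableSet_Ioc.compl ?_
        intro u hu
        have h0 := gaussianBump_nonneg k (a - u)
        have h0' := gaussianBump_nonneg k (-a - u)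
        have hx1 := le_abs_self x
        have hx2 := neg_abs_le x
        rw [Set.compl_Ioc] at hu
        rcases hu with hu | hu
        · refine (gaussianBump_le_mul (v := a - |x|) (w := -a - u) hk ?_).trans ?_
          · have hu' : u ≤ -a := hu
            nlinarith [mul_nonneg (sub_nonneg.2 hx) (sub_nonneg.2 hu')]
          · gcongr; linarith
        · refine (gaussianBump_le_mul (v := a - |x|) (w := a - u) hk ?_).trans ?_
          · have hu' : a ≤ u := le_of_lt hu
            nlinarith [mul_nonneg (sub_nonneg.2 hx) (sub_nonneg.2 hu')]
          · gcongr; linarith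
    _ = Real.exp (-k * (a - |x|) ^ 2) * ((∫ u in (Set.Ioc (-a) a)ᶜ, gaussianBump k (a - u)) +
          ∫ u in (Set.Ioc (-a) a)ᶜ, gaussianBump k (-a - u)) := by
        rw [integral_const_mul, integral_add (hi a).integrableOn (hi (-a)).integrableOn]
    _ ≤ Real.exp (-k * (a - |x|) ^ 2) * (1 + 1) := by
        gcongr <;> exact setIntegral_gaussianBump_le_one hk _ _
    _ = _ := by ring

/-- The Gaussian window extends to an entire function, of Gaussian growth off the real axis. -/
theorem exists_entire_gaussianWindow (k : ℝ) (ha : 0 ≤ a) :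
    ∃ r : ℂ → ℂ, Differentiable ℂ r ∧ (∀ x : ℝ, r x = gaussianWindow k a x) ∧
      ∀ z : ℂ, ‖r z‖ ≤ Real.exp (k * z.im ^ 2) * gaussianWindow k a z.re := by
  let φ : ℂ → ℂ := fun z => (√(k / Real.pi) : ℝ) * exp (-k * z ^ 2)
  have hφ : Differentiable ℂ φ := by fun_prop
  obtain ⟨Φ, hΦ⟩ := hφ.isExactOn_univ
  have hd : ∀ z, HasDerivAt Φ (φ z) z := fun z => hΦ z (Set.mem_univ z)
  have hΦd : Differentiable ℂ Φ := fun z => (hd z).differentiableAt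
  -- A difference of primitives is visibly entire; the integral form gives the values and the norm
  -- bound.
  have hr : ∀ z : ℂ, Φ (z + a) - Φ (z - a) = ∫ u in Set.Ioc (-a) a, φ (z - u) := by
    intro z
    have h1 : ∀ u : ℝ, HasDerivAt (fun u : ℝ => -Φ (z - u)) (φ (z - u)) u := by
      intro u
      have h2 : HasDerivAt (fun v : ℂ => -Φ (z - v)) (φ (z - u)) (u : ℂ) := by
        simpa using ((hd (z - u)).comp_const_sub z (u : ℂ)).fun_neg
      exact h2.comp_ofReal
    have hc : Continuous fun u : ℝ => φ (z - u) :=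
      hφ.continuous.comp (continuous_const.sub continuous_ofReal)
    rw [← intervalIntegral.integral_of_le (by linarith),
      intervalIntegral.integral_eq_sub_of_hasDerivAt (fun u _ => h1 u)
        (hc.intervalIntegrable _ _)]
    push_cast
    rw [sub_neg_eq_add z]
    ring
  refine ⟨fun z => Φ (z + a) - Φ (z - a), by fun_prop, fun x => ?_, fun z => ?_⟩
  · simp only [hr]
    rw [gaussianWindow, ← integral_complex_ofReal]
    refine integral_congr_ae (Eventually.of_forall fun u => ?_)
    simp [φ, gaussianBump]
  · simp only [hr]
    rw [gaussianWindow, ← integral_const_mul]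
    refine (norm_integral_le_integral_norm _).trans (le_of_eq ?_)
    refine integral_congr_ae (Eventually.of_forall fun u => ?_)
    simp only [φ, gaussianBump, norm_mul, norm_real, Complex.norm_exp, Real.norm_eq_abs,
      abs_of_nonneg (Real.sqrt_nonneg _)]
    rw [mul_left_comm, ← Real.exp_add]
    congr 2
    simp [pow_two]
    ring

end

theorem exp_half_le_one_add {t : ℝ} (h₀ : 0 ≤ t) (h₁ : t ≤ 1) : Real.exp (t / 2) ≤ 1 + t := by
  have h := Real.one_sub_le_exp_neg (t / 2)
  rw [Real.exp_neg] at h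
  have h2 : (1 - t / 2) * Real.exp (t / 2) ≤ 1 :=
    (le_mul_inv_iff₀ (Real.exp_pos _)).1 (by rwa [one_mul])
  nlinarith [Real.exp_pos (t / 2), mul_nonneg h₀ (sub_nonneg.2 h₁)]

theorem half_le_one_sub_exp_neg {t : ℝ} (h₀ : 0 ≤ t) (h₁ : t ≤ 1) :
    t / 2 ≤ 1 - Real.exp (-t) := by
  have h := Real.add_one_le_exp t
  have h2 : Real.exp (-t) * Real.exp t = 1 := by rw [← Real.exp_add]; simp
  nlinarith [Real.exp_pos (-t), mul_nonneg h₀ (sub_nonneg.2 h₁)]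

theorem norm_sub_one_add_norm_add_one_le (z : ℂ) {s : ℝ} (hs : 0 ≤ s) (h : |z.re| ≤ 1 + s) :
    ‖z - 1‖ + ‖z + 1‖ ≤ 2 + 2 * (s + |z.im|) := by
  have h1 := norm_le_abs_re_add_abs_im (z - 1)
  have h2 := norm_le_abs_re_add_abs_im (z + 1)
  simp only [sub_re, sub_im, add_re, add_im, one_re, one_im, sub_zero, add_zero] at h1 h2
  have h3 : |z.re - 1| + |z.re + 1| ≤ 2 + 2 * s := by
    rcases abs_cases (z.re - 1) with h | h <;> rcases abs_cases (z.re + 1) with h' | h' <;>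
      rcases abs_cases z.re with h'' | h'' <;> linarith
  linarith

/-! ### Polynomial approximation with controlled growth -/

/-- A function analytic and bounded inside a Bernstein ellipse is approximated, on an interval
slightly larger than `[-1, 1]`, by a polynomial of controlled growth. -/
theorem exists_polynomial_approx_of_bernstein {α δ ε L M : ℝ} {f : ℂ → ℂ} (hα : 0 < α)
    (hα₁ : α ≤ 1) (hf : AnalyticOnNhd ℂ f (bernsteinInterior (1 + α)))
    (hM : ∀ z ∈ bernsteinInterior (1 + α), ‖f z‖ ≤ M) (hδ : 0 < δ) (hδα : 200 * δ ≤ α ^ 2)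
    (hε : 0 < ε) (hε₁ : ε ≤ 1) (hL₁ : 1 ≤ L) (hL : 2 / (δ * ε) ≤ Real.exp L) :
    ∃ p : Polynomial ℂ,
      (∀ x : ℝ, |x| ≤ 1 + δ → ‖f x‖ ≤ M ∧ ‖f x - p.eval (x : ℂ)‖ ≤ M * (ε / 10)) ∧
      ∀ (z : ℂ) (s : ℝ), 0 ≤ s → ‖z - 1‖ + ‖z + 1‖ ≤ 2 + 2 * s →
        ‖p.eval z‖ ≤ M * Real.exp (L * (2 + √(s / δ))) := by
  obtain ⟨a, ha, hsum⟩ := exists_chebyshev_expansion (by linarith : 1 < 1 + α) hf hM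
  have hM0 : 0 ≤ M := by
    have : 0 ≤ 2 * M := le_trans (by positivity) (ha 0)
    linarith
  have hδα' : 200 * δ ≤ α := by nlinarith
  have hαδ : 200 / α ≤ 1 / δ := by rw [div_le_div_iff₀ hα hδ]; linarith
  -- Lets exponentials of L absorb the factors 1/α from the geometric series.
  have hEε : 400 / α ≤ ε * Real.exp L := by
    have : 2 / (δ * ε) = 2 * (1 / δ) / ε := by field_simp
    rw [this, div_le_iff₀ hε] at hL
    have h2 : 400 / α = 2 * (200 / α) := by ring
    linarith
  have hE1 : 1 ≤ Real.exp L := Real.one_le_exp (by linarith)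
  have hE2 : Real.exp (2 * L) = Real.exp L * Real.exp L := by rw [← Real.exp_add]; ring_nf
  have hEε2 : 400 / α ≤ ε * Real.exp (2 * L) := by
    rw [hE2]
    nlinarith [mul_le_mul_of_nonneg_left hE1 (mul_nonneg hε.le (Real.exp_pos L).le)]
  obtain ⟨n, hn, hn'⟩ : ∃ n : ℕ, 8 * L / α ≤ n ∧ n * α ≤ 9 * L := by
    refine ⟨⌈8 * L / α⌉₊, Nat.le_ceil _, ?_⟩
    have h := (Nat.ceil_lt_add_one (show 0 ≤ 8 * L / α by positivity)).le
    have h2 : 8 * L / α * α = 8 * L := by field_simp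
    nlinarith
  rw [div_le_iff₀ hα] at hn
  refine ⟨chebyshevPartialSum a n, fun x hx => ?_, fun z s hs hz => ?_⟩
  · obtain ⟨w, hw, hxw, hfoci⟩ := exists_joukowsky (x : ℂ)
    -- The constant 200 enters here: 2δ ≤ (α/10)².
    have hR : ‖w‖ ≤ Real.exp (α / 10) := by
      refine (le_exp_sqrt_of_add_inv_le hw hδ.le ?_).trans ?_
      · rw [hfoci]
        simpa using norm_sub_one_add_norm_add_one_le (x : ℂ) hδ.le (by simpa using hx)
      · rw [Real.exp_le_exp, Real.sqrt_le_left (by positivity)]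
        nlinarith
    have h1α : 0 < 1 + α := by linarith
    have hq : ‖w‖ / (1 + α) ≤ Real.exp (-(α / 4)) := by
      rw [div_le_iff₀ h1α]
      calc ‖w‖ ≤ Real.exp (α / 10) := hR
        _ ≤ Real.exp (-(α / 4) + α / 2) := Real.exp_le_exp.2 (by linarith)
        _ = Real.exp (-(α / 4)) * Real.exp (α / 2) := Real.exp_add _ _
        _ ≤ _ := by gcongr; exact exp_half_le_one_add hα.le hα₁
    have hlt : Real.exp (-(α / 4)) < 1 := by rw [← Real.exp_zero]; exact Real.exp_lt_exp.2 (by linarith)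
    have hwρ : ‖w‖ < 1 + α := (div_lt_one h1α).1 (hq.trans_lt hlt)
    have hgap : α / 8 ≤ 1 - ‖w‖ / (1 + α) := by
      have := half_le_one_sub_exp_neg (show 0 ≤ α / 4 by linarith) (by linarith)
      linarith
    rw [hxw]
    refine ⟨hM _ (mem_bernsteinInterior ((inv_lt_one_of_one_lt₀ (by linarith)).trans_le hw) hwρ),
      (norm_sub_chebyshevPartialSum_le ha hw hwρ (hsum w hw hwρ) n).trans ?_⟩
    have hpow : (‖w‖ / (1 + α)) ^ (n + 1) ≤ Real.exp (-(2 * L)) := by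
      calc (‖w‖ / (1 + α)) ^ (n + 1) ≤ Real.exp (-(α / 4)) ^ (n + 1) := by gcongr
        _ = Real.exp ((n + 1 : ℕ) * -(α / 4)) := (Real.exp_nat_mul _ _).symm
        _ ≤ _ := by
          rw [Real.exp_le_exp]
          push_cast
          nlinarith
    calc _ ≤ 2 * M * Real.exp (-(2 * L)) / (α / 8) := by gcongr
      _ = M * (16 / α * Real.exp (-(2 * L))) := by field_simp; ring
      _ ≤ M * (ε / 10) := by
        refine mul_le_mul_of_nonneg_left ?_ hM0
        rw [Real.exp_neg, ← div_eq_mul_inv, div_le_iff₀ (Real.exp_pos _)]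
        have : 400 / α = 25 * (16 / α) := by ring
        have : 0 ≤ 16 / α := by positivity
        linarith
  · obtain ⟨w, hw, hzw, hfoci⟩ := exists_joukowsky z
    rw [hzw]
    refine (norm_eval_chebyshevPartialSum_le (by linarith) ha hw n).trans ?_
    have hR : ‖w‖ ≤ Real.exp (√(2 * s)) := le_exp_sqrt_of_add_inv_le hw hs (by rw [hfoci]; exact hz)
    have hsq : n * √(2 * s) ≤ L * √(s / δ) := by
      rw [← Real.sqrt_sq (show (0 : ℝ) ≤ n by positivity), ← Real.sqrt_mul (by positivity),
        ← Real.sqrt_sq (show (0 : ℝ) ≤ L by linarith), ← Real.sqrt_mul (by positivity)]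
      refine Real.sqrt_le_sqrt ?_
      rw [← mul_div_assoc, le_div_iff₀ hδ]
      have h1 : (n * α) ^ 2 ≤ (9 * L) ^ 2 := by gcongr
      have h2 : (n : ℝ) ^ 2 * (200 * δ) ≤ n ^ 2 * α ^ 2 := by gcongr
      have h3 : (n : ℝ) ^ 2 * (2 * δ) ≤ L ^ 2 := by nlinarith [sq_nonneg L]
      nlinarith
    have hcoef : 2 * M * ((1 + α) / (1 + α - 1)) ≤ M * Real.exp (2 * L) := by
      rw [add_sub_cancel_left]
      calc 2 * M * ((1 + α) / α) ≤ 2 * M * (2 / α) := by gcongr; linarith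
        _ = M * (4 / α) := by ring
        _ ≤ _ := by
          gcongr
          have : 400 / α = 100 * (4 / α) := by ring
          have : 0 ≤ 4 / α := by positivity
          nlinarith [Real.exp_pos (2 * L)]
    calc _ ≤ M * Real.exp (2 * L) * Real.exp (√(2 * s)) ^ n := by gcongr
      _ = M * Real.exp (2 * L + n * √(2 * s)) := by
        rw [← Real.exp_nat_mul, mul_assoc, ← Real.exp_add]
      _ ≤ _ := by
        gcongr
        linarith

/-! ### Approximation of functions bounded on a strip -/

/-- Uniform approximation on `[-b, b]` of an entire function bounded on a strip. -/
theorem exists_polynomial_approx_of_strip {b δ G : ℝ} {g : ℂ → ℂ} (hδ : 0 < δ) (hb : 0 < b)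
    (hg : Differentiable ℂ g) (hG : ∀ z : ℂ, |z.im| ≤ δ → ‖g z‖ ≤ G) (n : ℕ) :
    ∃ q : Polynomial ℂ, q.natDegree ≤ n ∧ ∀ x : ℝ, |x| ≤ b →
      ‖g x - q.eval (x : ℂ)‖ ≤ 2 * G * (b / δ) / (1 + δ / b) ^ n := by
  have hη : 0 < δ / b := by positivity
  obtain ⟨a, ha, hsum⟩ := exists_chebyshev_expansion (by linarith : 1 < 1 + δ / b) (M := G)
    (f := fun z => g (b * z))
    (fun z _ => (hg.comp (differentiable_id.const_mul (b : ℂ))).analyticAt z)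
    (fun z hz => by
      simp only [bernsteinInterior, Set.mem_iUnion] at hz
      obtain ⟨r, hr, w, rfl, rfl⟩ := hz
      refine hG _ ?_
      have hw0 : 0 < ‖w‖ := by linarith [hr.1]
      have h1 : ((b : ℂ) * (1 / 2 * (w + w⁻¹))).im = b * (1 / 2) * (w.im * (1 - 1 / ‖w‖ ^ 2)) := by
        rw [← mul_assoc, show (b : ℂ) * (1 / 2) = ((b * (1 / 2) : ℝ) : ℂ) by push_cast; rfl,
          im_ofReal_mul, add_im, inv_im, normSq_eq_norm_sq]
        ring
      rw [h1, abs_mul, abs_mul (w.im), abs_of_pos (by positivity : 0 < b * (1 / 2))]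
      have h2 := abs_im_le_norm w
      have h3 : 1 / ‖w‖ ^ 2 ≤ 1 := by
        rw [div_le_one (by positivity)]; exact one_le_pow₀ hr.1
      -- The semi-minor axis (‖w‖ - ‖w‖⁻¹)/2 is at most δ/b, so dilation by `b` stays in the strip.
      have h4 : ‖w‖ * (1 - 1 / ‖w‖ ^ 2) ≤ 2 * (δ / b) := by
        have : ‖w‖ * (1 - 1 / ‖w‖ ^ 2) = (‖w‖ - 1) * (1 + 1 / ‖w‖) := by field_simp; ring
        rw [this]
        have h5 : 1 / ‖w‖ ≤ 1 := by rw [div_le_one hw0]; exact hr.1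
        nlinarith [hr.1, hr.2]
      rw [abs_of_nonneg (by linarith : 0 ≤ 1 - 1 / ‖w‖ ^ 2)]
      calc _ ≤ b * (1 / 2) * (‖w‖ * (1 - 1 / ‖w‖ ^ 2)) := by gcongr
        _ ≤ b * (1 / 2) * (2 * (δ / b)) := by gcongr
        _ = δ := by field_simp)
  refine ⟨(chebyshevPartialSum a n).comp (Polynomial.C (b⁻¹ : ℂ) * Polynomial.X), ?_, ?_⟩
  · refine Polynomial.natDegree_comp_le.trans ?_
    have := (Polynomial.natDegree_C_mul_le (b⁻¹ : ℂ) Polynomial.X).trans Polynomial.natDegree_X_le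
    calc _ ≤ n * 1 := Nat.mul_le_mul (natDegree_chebyshevPartialSum_le a n) this
      _ = n := mul_one n
  · intro x hx
    obtain ⟨w, hw, hxw, hfoci⟩ := exists_joukowsky ((b : ℂ)⁻¹ * x)
    have hw1 : ‖w‖ = 1 := by
      have h1 : ‖w‖ + ‖w‖⁻¹ ≤ 2 + 2 * 0 := by
        rw [hfoci]
        have := norm_sub_one_add_norm_add_one_le ((b : ℂ)⁻¹ * x) le_rfl (by
          rw [← ofReal_inv, ← ofReal_mul, ofReal_re, abs_mul, abs_of_pos (inv_pos.2 hb), add_zero,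
            ← div_eq_inv_mul, div_le_one hb]
          exact hx)
        rwa [← ofReal_inv, ← ofReal_mul, ofReal_im, abs_zero, add_zero, ofReal_mul,
          ofReal_inv] at this
      have := le_exp_sqrt_of_add_inv_le hw le_rfl h1
      simp only [mul_zero, Real.sqrt_zero, Real.exp_zero] at this
      exact le_antisymm this hw
    have hb0 : (b : ℂ) ≠ 0 := by exact_mod_cast hb.ne'
    have h := norm_sub_chebyshevPartialSum_le ha hw (by linarith) (hsum w hw (by linarith)) n
    rw [← hxw, mul_inv_cancel_left₀ hb0, hw1] at h
    rw [Polynomial.eval_comp, Polynomial.eval_mul, Polynomial.eval_C, Polynomial.eval_X]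
    refine h.trans (le_of_eq ?_)
    have h1 : 1 - 1 / (1 + δ / b) = (δ / b) / (1 + δ / b) := by field_simp; ring
    rw [h1, pow_succ, div_pow, one_pow]
    have : 1 + δ / b ≠ 0 := by positivity
    field_simp

/-! ### The filtered entire function -/

/-- An entire function which is close to `f` on `[-1, 1]`, small outside `[-(1 + δ), 1 + δ]`, and of
controlled size on the strip of half-width `δ`. -/
theorem exists_entire_approx_of_bernstein {α δ ε L M : ℝ} {f : ℂ → ℂ} (hα : 0 < α)
    (hα₁ : α ≤ 1) (hf : AnalyticOnNhd ℂ f (bernsteinInterior (1 + α)))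
    (hM : ∀ z ∈ bernsteinInterior (1 + α), ‖f z‖ ≤ M) (hδ : 0 < δ) (hδα : 200 * δ ≤ α ^ 2)
    (hε : 0 < ε) (hε₁ : ε ≤ 1) (hL₁ : 1 ≤ L) (hL : 2 / (δ * ε) ≤ Real.exp L) :
    ∃ g : ℂ → ℂ, Differentiable ℂ g ∧
      (∀ x : ℝ, |x| ≤ 1 → ‖f x - g x‖ ≤ M * (ε / 5)) ∧
      (∀ x : ℝ, |x| ≤ 1 + δ → ‖g x‖ ≤ M * (1 + ε / 10)) ∧
      (∀ x : ℝ, 1 + δ ≤ |x| → ‖g x‖ ≤ M * (ε / 10)) ∧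
      ∀ z : ℂ, |z.im| ≤ δ → ‖g z‖ ≤ M * Real.exp (24 * L) := by
  obtain ⟨p, hp, hgrow⟩ :=
    exists_polynomial_approx_of_bernstein hα hα₁ hf hM hδ hδα hε hε₁ hL₁ hL
  have hM0 : 0 ≤ M := (norm_nonneg _).trans (hp 0 (by simpa using by linarith)).1
  have hδα' : 200 * δ ≤ 1 := by nlinarith
  have hEε : 400 ≤ ε * Real.exp L := by
    rw [div_le_iff₀ (by positivity)] at hL
    nlinarith [mul_pos hε (Real.exp_pos L)]
  have hsmall : ∀ c, 1 ≤ c → Real.exp (-(c * L)) ≤ ε / 400 := by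
    intro c hc
    have h1 : Real.exp (-(c * L)) ≤ Real.exp (-L) := Real.exp_le_exp.2 (by nlinarith)
    refine h1.trans ?_
    rw [Real.exp_neg, inv_le_iff_one_le_mul₀ (Real.exp_pos _)]
    linarith
  have hk : 0 < 20 * L / δ ^ 2 := by positivity
  obtain ⟨r, hr, hrx, hrz⟩ :=
    exists_entire_gaussianWindow (20 * L / δ ^ 2) (show 0 ≤ 1 + δ / 2 by linarith)
  have hnr : ∀ x : ℝ, ‖r x‖ ≤ 1 := fun x => by
    rw [hrx, norm_real, Real.norm_of_nonneg (gaussianWindow_nonneg _ _ _)]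
    exact gaussianWindow_le_one hk x
  have hp1 : ∀ x : ℝ, |x| ≤ 1 + δ → ‖p.eval (x : ℂ)‖ ≤ M * (1 + ε / 10) := fun x hx => by
    have := norm_sub_norm_le (p.eval (x : ℂ)) (f x)
    have h2 := hp x hx
    rw [norm_sub_rev] at h2
    linarith
  -- τ is the distance to [-1, 1] in units of δ; the window's edge is at τ = 1/2.
  have hout : ∀ x : ℝ, 1 + δ ≤ |x| → ∃ τ, 1 ≤ τ ∧ |x| = 1 + τ * δ ∧
      gaussianWindow (20 * L / δ ^ 2) (1 + δ / 2) x ≤ Real.exp (-(20 * L * (τ - 1 / 2) ^ 2)) := by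
    intro x hx
    refine ⟨(|x| - 1) / δ, by rw [le_div_iff₀ hδ]; linarith, by field_simp; ring,
      (gaussianWindow_le_exp hk (by linarith)).trans (le_of_eq ?_)⟩
    congr 1
    field_simp
    ring
  refine ⟨fun z => p.eval z * r z, p.differentiable.mul hr, fun x hx => ?_, fun x hx => ?_,
    fun x hx => ?_, fun z hz => ?_⟩
  · have h1 := one_sub_gaussianWindow_le hk (show |x| ≤ 1 + δ / 2 by linarith)
    have h2 : Real.exp (-(20 * L / δ ^ 2) * (1 + δ / 2 - |x|) ^ 2) ≤ ε / 400 := by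
      refine le_trans (Real.exp_le_exp.2 ?_) (hsmall 5 (by norm_num))
      have h3 : (δ / 2) ^ 2 ≤ (1 + δ / 2 - |x|) ^ 2 := by gcongr; linarith
      have h4 := mul_le_mul_of_nonneg_left h3 hk.le
      have h5 : 20 * L / δ ^ 2 * (δ / 2) ^ 2 = 5 * L := by field_simp; ring
      linarith
    have h6 : ‖(1 : ℂ) - r x‖ ≤ ε / 200 := by
      rw [hrx, ← ofReal_one, ← ofReal_sub, norm_real, Real.norm_of_nonneg
        (sub_nonneg.2 (gaussianWindow_le_one hk x))]
      linarith
    have h7 := hp1 x (by linarith)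
    calc ‖f x - p.eval (x : ℂ) * r x‖
        = ‖(f x - p.eval (x : ℂ)) + p.eval (x : ℂ) * (1 - r x)‖ := by ring_nf
      _ ≤ ‖f x - p.eval (x : ℂ)‖ + ‖p.eval (x : ℂ)‖ * ‖1 - r x‖ := by
          rw [← norm_mul]; exact norm_add_le _ _
      _ ≤ M * (ε / 10) + M * (1 + ε / 10) * (ε / 200) := by
          gcongr; exact (hp x (by linarith)).2
      _ = M * (ε / 10 + (1 + ε / 10) * (ε / 200)) := by ring
      _ ≤ M * (ε / 5) := by
          refine mul_le_mul_of_nonneg_left ?_ hM0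
          nlinarith
  · rw [norm_mul, ← mul_one (M * (1 + ε / 10))]
    gcongr
    exacts [hp1 x hx, hnr x]
  · obtain ⟨τ, hτ, hxτ, hw⟩ := hout x hx
    have h1 := hgrow x (τ * δ) (by positivity) (by
      simpa using norm_sub_one_add_norm_add_one_le (x : ℂ) (s := τ * δ) (by positivity)
        (by simpa using hxτ.le))
    have hsq : √(τ * δ / δ) ≤ τ := by
      rw [mul_div_cancel_right₀ _ hδ.ne', Real.sqrt_le_left (by linarith)]
      nlinarith
    rw [norm_mul, hrx, norm_real, Real.norm_of_nonneg (gaussianWindow_nonneg _ _ _)]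
    calc _ ≤ M * Real.exp (L * (2 + τ)) * Real.exp (-(20 * L * (τ - 1 / 2) ^ 2)) := by
          refine mul_le_mul (h1.trans ?_) hw (gaussianWindow_nonneg _ _ _) (by positivity)
          gcongr
      _ = M * Real.exp (L * (2 + τ - 20 * (τ - 1 / 2) ^ 2)) := by
          rw [mul_assoc, ← Real.exp_add]; ring_nf
      _ ≤ M * Real.exp (-(2 * L)) := by
          gcongr
          -- Equality at τ = 1; this fixes the 20 in the Gaussian's exponent.
          have : 2 + τ - 20 * (τ - 1 / 2) ^ 2 ≤ -2 := by nlinarith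
          nlinarith
      _ ≤ M * (ε / 10) := by
          gcongr
          linarith [hsmall 2 (by norm_num)]
  · have hrz' : ‖r z‖ ≤ Real.exp (20 * L) *
        gaussianWindow (20 * L / δ ^ 2) (1 + δ / 2) z.re := by
      refine (hrz z).trans (mul_le_mul_of_nonneg_right (Real.exp_le_exp.2 ?_)
        (gaussianWindow_nonneg _ _ _))
      have h1 : z.im ^ 2 ≤ δ ^ 2 := by rw [← sq_abs]; gcongr
      calc _ ≤ 20 * L / δ ^ 2 * δ ^ 2 := by gcongr
        _ = 20 * L := by field_simp
    rw [norm_mul]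
    rcases le_total |z.re| (1 + δ) with h | h
    · have h1 := hgrow z (2 * δ) (by positivity)
        ((norm_sub_one_add_norm_add_one_le z hδ.le h).trans (by linarith))
      have hsq : √(2 * δ / δ) ≤ 2 := by
        rw [mul_div_cancel_right₀ _ hδ.ne', Real.sqrt_le_left (by norm_num)]
        norm_num
      calc _ ≤ M * Real.exp (L * (2 + 2)) * (Real.exp (20 * L) * 1) := by
            refine mul_le_mul (h1.trans ?_) (hrz'.trans ?_) (norm_nonneg _) (by positivity)
            · gcongr
            · gcongr
              exact gaussianWindow_le_one hk _
        _ = _ := by rw [mul_one, mul_assoc, ← Real.exp_add]; ring_nf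
    · obtain ⟨τ, hτ, hxτ, hw⟩ := hout z.re h
      have h1 := hgrow z ((τ + 1) * δ) (by positivity)
        ((norm_sub_one_add_norm_add_one_le z (s := τ * δ) (by positivity) hxτ.le).trans
          (by linarith))
      have hsq : √((τ + 1) * δ / δ) ≤ τ + 1 := by
        rw [mul_div_cancel_right₀ _ hδ.ne', Real.sqrt_le_left (by linarith)]
        nlinarith
      calc _ ≤ M * Real.exp (L * (2 + (τ + 1))) *
            (Real.exp (20 * L) * Real.exp (-(20 * L * (τ - 1 / 2) ^ 2))) := by
            refine mul_le_mul (h1.trans ?_) (hrz'.trans ?_) (norm_nonneg _) (by positivity)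
            · gcongr
            · gcongr
        _ = M * Real.exp (L * (23 + τ - 20 * (τ - 1 / 2) ^ 2)) := by
            rw [mul_assoc, ← Real.exp_add, ← Real.exp_add]; ring_nf
        _ ≤ M * Real.exp (24 * L) := by
            rw [mul_comm 24 L]
            gcongr
            nlinarith

/-! ### The polynomial filter -/

/-- Polynomial approximation on `[-1, 1]` of a function analytic inside a Bernstein ellipse, with
filtering outside `[-(1 + δ), 1 + δ]`. -/
theorem exists_polynomial_filter_of_bernstein {α δ ε b L M : ℝ} {f : ℂ → ℂ} (hα : 0 < α)
    (hα₁ : α ≤ 1) (hf : AnalyticOnNhd ℂ f (bernsteinInterior (1 + α)))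
    (hM : ∀ z ∈ bernsteinInterior (1 + α), ‖f z‖ ≤ M) (hδ : 0 < δ) (hδα : 200 * δ ≤ α ^ 2)
    (hε : 0 < ε) (hε₁ : ε ≤ 1) (hb : 2 ≤ b) (hL : b / (δ * ε) = Real.exp L) :
    ∃ q : Polynomial ℂ, (q.natDegree : ℝ) ≤ 61 * (b / δ * L) ∧
      (∀ x : ℝ, |x| ≤ 1 → ‖f x - q.eval (x : ℂ)‖ ≤ M * ε) ∧
      (∀ x : ℝ, |x| ≤ 1 + δ → ‖q.eval (x : ℂ)‖ ≤ M) ∧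
      ∀ x : ℝ, 1 + δ ≤ |x| → |x| ≤ b → ‖q.eval (x : ℂ)‖ ≤ M * ε := by
  have hδα' : 200 * δ ≤ 1 := by nlinarith
  have hb0 : 0 < b := by linarith
  have hL2 : 2 / (δ * ε) ≤ Real.exp L := by rw [← hL]; gcongr
  have hEε : 400 ≤ ε * Real.exp L := by
    rw [div_le_iff₀ (by positivity)] at hL2
    nlinarith [mul_pos hε (Real.exp_pos L)]
  have hE400 : 400 ≤ Real.exp L := by nlinarith [Real.exp_pos L]
  have hL₁ : 1 ≤ L := by
    rw [← Real.exp_le_exp]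
    linarith [Real.exp_one_lt_d9]
  obtain ⟨g, hg, h₁, h₂, h₃, h₄⟩ :=
    exists_entire_approx_of_bernstein hα hα₁ hf hM hδ hδα hε hε₁ hL₁ hL2
  have hM0 : 0 ≤ M := by
    have : 0 ≤ M * (ε / 5) := (norm_nonneg _).trans (h₁ 0 (by simp))
    exact nonneg_of_mul_nonneg_left this (by positivity)
  obtain ⟨n, hn, hn'⟩ : ∃ n : ℕ, 60 * (b / δ * L) ≤ n ∧ n ≤ 61 * (b / δ * L) := by
    refine ⟨⌈60 * (b / δ * L)⌉₊, Nat.le_ceil _, ?_⟩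
    have h := (Nat.ceil_lt_add_one (show 0 ≤ 60 * (b / δ * L) by positivity)).le
    have h2 : 1 ≤ b / δ := by rw [one_le_div hδ]; linarith
    nlinarith
  obtain ⟨q, hq, hgq⟩ := exists_polynomial_approx_of_strip hδ hb0 hg h₄ n
  have herr : ∀ x : ℝ, |x| ≤ b → ‖g x - q.eval (x : ℂ)‖ ≤ M * (ε / 10) := by
    intro x hx
    refine (hgq x hx).trans ?_
    have hη : δ / b ≤ 1 := by rw [div_le_one hb0]; linarith
    -- The 30L pays 24L for the strip bound and L for b/δ; the remaining 5L yields ε/10.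
    have hpow : Real.exp (30 * L) ≤ (1 + δ / b) ^ n := by
      calc Real.exp (30 * L) ≤ Real.exp (n * (δ / b / 2)) := by
            refine Real.exp_le_exp.2 ?_
            have := mul_le_mul_of_nonneg_right hn (show 0 ≤ δ / b / 2 by positivity)
            have h2 : 60 * (b / δ * L) * (δ / b / 2) = 30 * L := by field_simp; ring
            linarith
        _ = Real.exp (δ / b / 2) ^ n := Real.exp_nat_mul _ _
        _ ≤ _ := by gcongr; exact exp_half_le_one_add (by positivity) hη
    have hbδ : b / δ ≤ Real.exp L := by
      rw [← hL]
      gcongr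
      nlinarith
    have h30 : Real.exp (30 * L) = Real.exp (24 * L) * Real.exp L * Real.exp (5 * L) := by
      rw [← Real.exp_add, ← Real.exp_add]; ring_nf
    have h5 : Real.exp L ≤ Real.exp (5 * L) := Real.exp_le_exp.2 (by linarith)
    rw [div_le_iff₀ (by positivity)]
    calc 2 * (M * Real.exp (24 * L)) * (b / δ)
        ≤ 2 * (M * Real.exp (24 * L)) * Real.exp L := by gcongr
      _ = M * (Real.exp (24 * L) * Real.exp L * 2) := by ring
      _ ≤ M * (Real.exp (24 * L) * Real.exp L * (ε / 10 * Real.exp (5 * L))) := by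
          gcongr
          nlinarith
      _ = M * (ε / 10) * Real.exp (30 * L) := by rw [h30]; ring
      _ ≤ _ := by gcongr
  have hq' : ∀ x : ℝ, |x| ≤ b → ‖q.eval (x : ℂ)‖ ≤ ‖g x‖ + M * (ε / 10) := fun x hx => by
    have := norm_sub_norm_le (q.eval (x : ℂ)) (g x)
    have h2 := herr x hx
    rw [norm_sub_rev] at h2
    linarith
  -- On the middle interval `q` may exceed M by ε/10 from `g` and ε/10 from the truncation.
  set c : ℝ := (1 + ε / 5)⁻¹ with hc
  have hc0 : 0 < c := by positivity
  have hc1 : c * (1 + ε / 5) = 1 := inv_mul_cancel₀ (by positivity)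
  have hnorm : ∀ x : ℝ, ‖(Polynomial.C (c : ℂ) * q).eval (x : ℂ)‖ = c * ‖q.eval (x : ℂ)‖ := by
    intro x
    rw [Polynomial.eval_mul, Polynomial.eval_C, norm_mul, norm_real, Real.norm_of_nonneg hc0.le]
  have hmid : ∀ x : ℝ, |x| ≤ 1 + δ → ‖q.eval (x : ℂ)‖ ≤ M * (1 + ε / 5) := fun x hx => by
    have h1 := hq' x (by linarith)
    have h2 := h₂ x hx
    linarith
  refine ⟨Polynomial.C (c : ℂ) * q, ?_, fun x hx => ?_, fun x hx => ?_, fun x hx hx' => ?_⟩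
  · have : (Polynomial.C (c : ℂ) * q).natDegree ≤ n := (Polynomial.natDegree_C_mul_le _ _).trans hq
    exact le_trans (by exact_mod_cast this) hn'
  · have h1 := hmid x (by linarith)
    rw [Polynomial.eval_mul, Polynomial.eval_C]
    have hc2 : 1 - c = c * (ε / 5) := by linarith
    calc ‖f x - c * q.eval (x : ℂ)‖
        = ‖(f x - g x) + (g x - q.eval (x : ℂ)) + ((1 - c : ℝ) : ℂ) * q.eval (x : ℂ)‖ := by
          push_cast; ring_nf
      _ ≤ ‖f x - g x‖ + ‖g x - q.eval (x : ℂ)‖ + (1 - c) * ‖q.eval (x : ℂ)‖ := by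
          refine (norm_add₃_le).trans (le_of_eq ?_)
          rw [norm_mul, norm_real, Real.norm_of_nonneg (by rw [hc2]; positivity)]
      _ ≤ M * (ε / 5) + M * (ε / 10) + c * (ε / 5) * (M * (1 + ε / 5)) := by
          rw [hc2]
          gcongr
          exacts [h₁ x hx, herr x (by linarith)]
      _ = M * (ε / 5) + M * (ε / 10) + (c * (1 + ε / 5)) * (M * (ε / 5)) := by ring
      _ ≤ M * ε := by
          rw [hc1]
          nlinarith [mul_nonneg hM0 hε.le]
  · rw [hnorm]
    calc _ ≤ c * (M * (1 + ε / 5)) := by gcongr; exact hmid x hx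
      _ = (c * (1 + ε / 5)) * M := by ring
      _ = M := by rw [hc1, one_mul]
  · rw [hnorm]
    have h1 := hq' x hx'
    have h2 := h₃ x hx
    have hc3 : c ≤ 1 := inv_le_one_of_one_le₀ (by linarith)
    have h4 : 0 ≤ M * ε := by positivity
    calc _ ≤ 1 * ‖q.eval (x : ℂ)‖ := by gcongr
      _ ≤ _ := by linarith

/-! ### Symmetrization -/

/-- `q` has degree at most `D`, is `A`-close to `f` on `[-1, 1]`, at most `M` on
`[-(1 + δ), 1 + δ]`, and at most `B` on the rest of `[-b, b]`. -/
def IsFilteredApprox (f : ℂ → ℂ) (D A M B δ b : ℝ) (q : Polynomial ℂ) : Prop :=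
  (q.natDegree : ℝ) ≤ D ∧ (∀ x : ℝ, |x| ≤ 1 → ‖f x - q.eval (x : ℂ)‖ ≤ A) ∧
    (∀ x : ℝ, |x| ≤ 1 + δ → ‖q.eval (x : ℂ)‖ ≤ M) ∧
    ∀ x : ℝ, 1 + δ ≤ |x| → |x| ≤ b → ‖q.eval (x : ℂ)‖ ≤ B

namespace IsFilteredApprox

variable {f : ℂ → ℂ} {D A M B δ b : ℝ} {p q : Polynomial ℂ}

theorem average (hp : IsFilteredApprox f D A M B δ b p) (hq : IsFilteredApprox f D A M B δ b q) :
    IsFilteredApprox f D A M B δ b (Polynomial.C (1 / 2) * (p + q)) := by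
  have key : ∀ {u v : ℂ} {c : ℝ}, ‖u‖ ≤ c → ‖v‖ ≤ c → ‖1 / 2 * (u + v)‖ ≤ c := by
    intro u v c hu hv
    have h := norm_add_le u v
    rw [norm_mul, show ‖(1 / 2 : ℂ)‖ = 1 / 2 by norm_num]
    linarith
  obtain ⟨hp₁, hp₂, hp₃, hp₄⟩ := hp
  obtain ⟨hq₁, hq₂, hq₃, hq₄⟩ := hq
  refine ⟨?_, fun x hx => ?_, fun x hx => ?_, fun x hx hx' => ?_⟩
  · have h : (Polynomial.C (1 / 2) * (p + q)).natDegree ≤ max p.natDegree q.natDegree :=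
      (Polynomial.natDegree_C_mul_le _ _).trans (Polynomial.natDegree_add_le _ _)
    rcases le_max_iff.1 h with h | h
    · exact le_trans (by exact_mod_cast h) hp₁
    · exact le_trans (by exact_mod_cast h) hq₁
  all_goals simp only [Polynomial.eval_mul, Polynomial.eval_C, Polynomial.eval_add]
  · convert key (hp₂ x hx) (hq₂ x hx) using 2
    ring
  · exact key (hp₃ x hx) (hq₃ x hx)
  · exact key (hp₄ x hx hx') (hq₄ x hx hx')

theorem comp_neg (hq : IsFilteredApprox f D A M B δ b q)
    (hf : ∀ x : ℝ, |x| ≤ 1 → f (-x) = f x) :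
    IsFilteredApprox f D A M B δ b (q.comp (-Polynomial.X)) := by
  obtain ⟨h₁, h₂, h₃, h₄⟩ := hq
  have e : ∀ x : ℝ, (q.comp (-Polynomial.X)).eval (x : ℂ) = q.eval ((-x : ℝ) : ℂ) := by
    intro x; simp
  refine ⟨by simpa [Polynomial.natDegree_comp] using h₁, fun x hx => ?_, fun x hx => ?_,
    fun x hx hx' => ?_⟩ <;> rw [e]
  · have := h₂ (-x) (by rwa [abs_neg])
    rwa [ofReal_neg, hf x hx, ← ofReal_neg] at this
  · exact h₃ (-x) (by rwa [abs_neg])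
  · exact h₄ (-x) (by rwa [abs_neg]) (by rwa [abs_neg])

theorem neg_comp_neg (hq : IsFilteredApprox f D A M B δ b q)
    (hf : ∀ x : ℝ, |x| ≤ 1 → f (-x) = -f x) :
    IsFilteredApprox f D A M B δ b (-q.comp (-Polynomial.X)) := by
  obtain ⟨h₁, h₂, h₃, h₄⟩ := hq
  have e : ∀ x : ℝ, (-q.comp (-Polynomial.X)).eval (x : ℂ) = -q.eval ((-x : ℝ) : ℂ) := by
    intro x; simp
  refine ⟨by simpa [Polynomial.natDegree_comp] using h₁, fun x hx => ?_, fun x hx => ?_,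
    fun x hx hx' => ?_⟩ <;> rw [e]
  · have := h₂ (-x) (by rwa [abs_neg])
    rwa [ofReal_neg, hf x hx, ← norm_neg, neg_sub', neg_neg, ← ofReal_neg] at this
  · rw [norm_neg]; exact h₃ (-x) (by rwa [abs_neg])
  · rw [norm_neg]; exact h₄ (-x) (by rwa [abs_neg]) (by rwa [abs_neg])

theorem map_conj (hq : IsFilteredApprox f D A M B δ b q)
    (hf : ∀ x : ℝ, |x| ≤ 1 → (f x).im = 0) :
    IsFilteredApprox f D A M B δ b (q.map (starRingEnd ℂ)) := by
  obtain ⟨h₁, h₂, h₃, h₄⟩ := hq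
  have e : ∀ x : ℝ, (q.map (starRingEnd ℂ)).eval (x : ℂ) = starRingEnd ℂ (q.eval (x : ℂ)) := by
    intro x
    simpa using Polynomial.eval_map_apply (f := starRingEnd ℂ) (p := q) (x : ℂ)
  refine ⟨le_trans (by exact_mod_cast Polynomial.natDegree_map_le) h₁, fun x hx => ?_,
    fun x hx => ?_, fun x hx hx' => ?_⟩ <;> rw [e]
  · rw [← conj_eq_iff_im.2 (hf x hx), ← map_sub, norm_conj]
    exact h₂ x hx
  · rw [norm_conj]; exact h₃ x hx
  · rw [norm_conj]; exact h₄ x hx hx'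

/-- A filtered approximation may be chosen with the symmetries of the approximated function. -/
theorem exists_symmetric (hq : IsFilteredApprox f D A M B δ b q) :
    ∃ p : Polynomial ℂ, IsFilteredApprox f D A M B δ b p ∧
      ((∀ x : ℝ, |x| ≤ 1 → f (-x) = f x) → ∀ z : ℂ, p.eval (-z) = p.eval z) ∧
      ((∀ x : ℝ, |x| ≤ 1 → f (-x) = -f x) → ∀ z : ℂ, p.eval (-z) = -p.eval z) ∧
      ((∀ x : ℝ, |x| ≤ 1 → (f x).im = 0) → ∀ n : ℕ, (p.coeff n).im = 0) := by
  obtain ⟨q₁, g₁, e₁⟩ : ∃ p, IsFilteredApprox f D A M B δ b p ∧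
      ((∀ x : ℝ, |x| ≤ 1 → f (-x) = f x) → ∀ z : ℂ, p.eval (-z) = p.eval z) := by
    by_cases h : ∀ x : ℝ, |x| ≤ 1 → f (-x) = f x
    · exact ⟨_, hq.average (hq.comp_neg h), fun _ z => by simp [add_comm]⟩
    · exact ⟨q, hq, fun h' => absurd h' h⟩
  obtain ⟨q₂, g₂, e₂, o₂⟩ : ∃ p, IsFilteredApprox f D A M B δ b p ∧
      ((∀ x : ℝ, |x| ≤ 1 → f (-x) = f x) → ∀ z : ℂ, p.eval (-z) = p.eval z) ∧
      ((∀ x : ℝ, |x| ≤ 1 → f (-x) = -f x) → ∀ z : ℂ, p.eval (-z) = -p.eval z) := by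
    by_cases h : ∀ x : ℝ, |x| ≤ 1 → f (-x) = -f x
    · refine ⟨_, g₁.average (g₁.neg_comp_neg h), fun h' z => ?_, fun _ z => ?_⟩
      · simp [e₁ h' z]
      · simp only [Polynomial.eval_mul, Polynomial.eval_C, Polynomial.eval_add,
          Polynomial.eval_neg, Polynomial.eval_comp, Polynomial.eval_X, neg_neg]
        ring
    · exact ⟨q₁, g₁, e₁, fun h' => absurd h' h⟩
  by_cases h : ∀ x : ℝ, |x| ≤ 1 → (f x).im = 0
  · have e : ∀ z : ℂ, (q₂.map (starRingEnd ℂ)).eval z =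
        starRingEnd ℂ (q₂.eval (starRingEnd ℂ z)) := by
      intro z
      simpa using Polynomial.eval_map_apply (f := starRingEnd ℂ) (p := q₂) (starRingEnd ℂ z)
    refine ⟨_, g₂.average (g₂.map_conj h), fun h' z => ?_, fun h' z => ?_, fun _ n => ?_⟩
    · simp only [Polynomial.eval_mul, Polynomial.eval_C, Polynomial.eval_add, e, map_neg, e₂ h']
    · simp only [Polynomial.eval_mul, Polynomial.eval_C, Polynomial.eval_add, e, map_neg, o₂ h']
      ring
    · rw [Polynomial.coeff_C_mul, Polynomial.coeff_add, Polynomial.coeff_map, add_conj,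
        show (1 / 2 : ℂ) = ((1 / 2 : ℝ) : ℂ) by push_cast; rfl, ← ofReal_mul, ofReal_im]
  · exact ⟨q₂, g₂, e₂, o₂, fun h' => absurd h' h⟩

end IsFilteredApprox

/-! ### Assembly -/

theorem theorem3p4 :
    ∃ C : ℝ, 0 < C ∧ ∃ K : ℝ, 0 < K ∧
      ∀ (α M : ℝ) (f : ℂ → ℂ), 0 < α →
        AnalyticOnNhd ℂ f (bernsteinInterior (1 + α)) →
        (∀ z ∈ bernsteinInterior (1 + α), ‖f z‖ ≤ M) →
        ∀ δ ε b : ℝ, 0 < δ → δ < (1 / C) * min 1 (α ^ 2) → 0 < ε → ε < 1 → 1 < b →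
          ∃ q : Polynomial ℂ,
            (q.natDegree : ℝ) ≤ K * ((b / δ) * Real.log (b / (δ * ε))) ∧
            (∀ x : ℝ, x ∈ Set.Icc (-1) 1 → ‖f (x : ℂ) - q.eval (x : ℂ)‖ ≤ M * ε) ∧
            (∀ x : ℝ, x ∈ Set.Icc (-(1 + δ)) (1 + δ) → ‖q.eval (x : ℂ)‖ ≤ M) ∧
            (∀ x : ℝ, x ∈ Set.Icc (-b) (-(1 + δ)) ∪ Set.Icc (1 + δ) b →
              ‖q.eval (x : ℂ)‖ ≤ M * ε) ∧
            ((∀ x : ℝ, x ∈ Set.Icc (-1) 1 → f (-(x : ℂ)) = f (x : ℂ)) →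
              ∀ z : ℂ, q.eval (-z) = q.eval z) ∧
            ((∀ x : ℝ, x ∈ Set.Icc (-1) 1 → f (-(x : ℂ)) = -f (x : ℂ)) →
              ∀ z : ℂ, q.eval (-z) = -q.eval z) ∧
            ((∀ x : ℝ, x ∈ Set.Icc (-1) 1 → (f (x : ℂ)).im = 0) →
              ∀ n : ℕ, (q.coeff n).im = 0) := by
  -- 244 = 61 · 2 · 2: one factor from replacing b by 2b, one from log(2y) ≤ 2 log y for y ≥ 2.
  refine ⟨200, by norm_num, 244, by norm_num, ?_⟩
  intro α M f hα hf hM δ ε b hδ hδα hε hε₁ hb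
  have hsub : bernsteinInterior (1 + min 1 α) ⊆ bernsteinInterior (1 + α) :=
    bernsteinInterior_mono (by gcongr; exact min_le_right _ _)
  have hmin : 200 * δ ≤ min 1 α ^ 2 := by
    rcases le_total 1 α with h | h
    · rw [min_eq_left h]
      linarith [min_le_left 1 (α ^ 2)]
    · rw [min_eq_right h]
      linarith [min_le_right 1 (α ^ 2)]
  have hδ₁ : 200 * δ ≤ 1 := by linarith [min_le_left 1 (α ^ 2)]
  have hlarge : 2 ≤ b / (δ * ε) := by
    rw [le_div_iff₀ (by positivity)]
    nlinarith [mul_pos hδ hε]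
  -- Doubling b makes [-2b, 2b] contain [-(1+δ), 1+δ] even when b is close to 1.
  obtain ⟨q, hq⟩ := exists_polynomial_filter_of_bernstein (b := 2 * b)
    (L := Real.log (2 * b / (δ * ε))) (lt_min one_pos hα) (min_le_left 1 α)
    (hf.mono hsub) (fun z hz => hM z (hsub hz)) hδ hmin hε hε₁.le (by linarith)
    (Real.exp_log (by positivity)).symm
  obtain ⟨p, ⟨h₁, h₂, h₃, h₄⟩, hev, hodd, hreal⟩ := IsFilteredApprox.exists_symmetric hq
  have hIcc : ∀ x : ℝ, |x| ≤ 1 → x ∈ Set.Icc (-1 : ℝ) 1 := fun x hx => abs_le.1 hx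
  refine ⟨p, h₁.trans ?_, fun x hx => h₂ x (abs_le.2 hx), fun x hx => h₃ x (abs_le.2 hx),
    fun x hx => ?_, fun h => hev fun x hx => h x (hIcc x hx),
    fun h => hodd fun x hx => h x (hIcc x hx), fun h => hreal fun x hx => h x (hIcc x hx)⟩
  · have hlog : Real.log (2 * b / (δ * ε)) ≤ 2 * Real.log (b / (δ * ε)) := by
      rw [mul_div_assoc, Real.log_mul two_ne_zero (by positivity)]
      linarith [Real.log_le_log two_pos hlarge]
    calc 61 * (2 * b / δ * Real.log (2 * b / (δ * ε)))
        ≤ 61 * (2 * b / δ * (2 * Real.log (b / (δ * ε)))) := by gcongr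
      _ = _ := by ring
  · rcases hx with hx | hx
    · have hx0 : x ≤ 0 := by linarith [hx.2]
      refine h₄ x ?_ ?_ <;> rw [abs_of_nonpos hx0] <;> linarith [hx.1, hx.2]
    · have hx0 : 0 ≤ x := by linarith [hx.1]
      refine h₄ x ?_ ?_ <;> rw [abs_of_nonneg hx0] <;> linarith [hx.1, hx.2]
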